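/- Let $k>1$ be an integer and let $\gamma=1/g$ for some integer $g\ge 2$. Let $V=[n]^k$ be the $k$-dimensional torus grid with grid distance $d_M(u,v)=\sum_{i=1}^k\min\{|v_i-u_i|,\,n-|v_i-u_i|\}$. In the distance-reciprocity balanced (DRB) game the players are the nodes $u\in V$, each has the strategy set $\Sigma=\{0,\gamma,2\gamma,3\gamma,\dots\}$, and the payoff of $u$ in the profile $\mathbf r=(r_v)_{v\in V}$ is $$\pi_u(\mathbf r)=\Big(\sum_{v\ne u}p_u(v,r_u)\,d_M(u,v)\Big)\Big(\sum_{v\ne u}p_u(v,r_u)\,p_v(u,r_v)\Big),\qquad p_u(v,s)=\frac{d_M(u,v)^{-s}}{\sum_{w\ne u}d_M(u,w)^{-s}}.$$ In a synchronous step of the best response dynamic all nodes simultaneously move to best responses to the current profile; in an asynchronous step a single node moves to a best response to the current profile. Theorem. Let $\beta>0$ and $0<\varepsilon<\gamma/2$ be constants. There is an $n_0\in\mathbb N$, depending only on $k,\gamma,\varepsilon,\beta$, such that the following holds for all $n\ge n_0$ and every finite set $S\subset\Sigma$ with $0<\max S\le\beta$. Start from the profile $\mathbf r\equiv 0$ and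 perturb it at random: the events $\{r_u\in S\setminus\{0\}\}$, $u\in V$, are mutually independent, each has probability at least $n^{-\frac{(k-1)\varepsilon}{k+\beta}}$, and a node for which the event does not occur keeps $r_u=0$. Then with probability at least $1-1/n$ the perturbed profile $\mathbf r$ has both of the following properties. (a) One synchronous step of the best response dynamic leads from $\mathbf r$ to the navigable small world $\mathbf r'\equiv k$, and to no other profile. (b) For every finite sequence of nodes in which each node occurs at least once, letting the nodes of the sequence take asynchronous best response steps in that order, starting from $\mathbf r$, is possible and always ends in the navigable small world $\mathbf r'\equiv k$. -/

import Mathlib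

open MeasureTheory ProbabilityTheory

/-- The nodes of the `k`-dimensional `n × ⋯ × n` grid with wrap-around (a torus). -/
abbrev GridNode (n k : ℕ) : Type := Fin k → Fin n

/-- The grid (Manhattan) distance on the torus:
the sum over the coordinates of `min (|vᵢ - uᵢ|, n - |vᵢ - uᵢ|)`. -/
def gridDist {n k : ℕ} (u v : GridNode n k) : ℕ :=
  ∑ i, min (((v i : ℕ) : ℤ) - ((u i : ℕ) : ℤ)).natAbs
    (n - (((v i : ℕ) : ℤ) - ((u i : ℕ) : ℤ)).natAbs)

/-- The strategy set `Σ = {0, γ, 2γ, 3γ, …}` of connection preferences. -/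
def strategySet (γ : ℝ) : Set ℝ := {x | ∃ m : ℕ, x = m * γ}

/-- A profile of connection preferences, one for every node. -/
abbrev Profile (n k : ℕ) : Type := GridNode n k → ℝ

/-- The normalization constant `c(s) = ∑_{v ≠ u} d(u, v)^{-s}` at the node `u`. -/
noncomputable def linkNorm {n k : ℕ} (u : GridNode n k) (s : ℝ) : ℝ :=
  ∑ v ∈ Finset.univ.erase u, (gridDist u v : ℝ) ^ (-s)

/-- The probability `p_u(v, s) = d(u, v)^{-s} / c(s)` that a long-range link of `u`, with
connection preference `s`, ends at `v ≠ u`. -/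
noncomputable def linkProb {n k : ℕ} (u v : GridNode n k) (s : ℝ) : ℝ :=
  (gridDist u v : ℝ) ^ (-s) / linkNorm u s

/-- The mean grid distance of the long-range contacts of `u` with connection preference `s`. -/
noncomputable def meanDist {n k : ℕ} (u : GridNode n k) (s : ℝ) : ℝ :=
  ∑ v ∈ Finset.univ.erase u, linkProb u v s * (gridDist u v : ℝ)

/-- The reciprocity of `u` in the profile `r`: the mean probability that `u` forms a bidirectional
link with its long-range contacts. -/
noncomputable def reciprocity {n k : ℕ} (r : Profile n k) (u : GridNode n k) : ℝ :=
  ∑ v ∈ Finset.univ.erase u, linkProb u v (r u) * linkProb v u (r v)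

/-- The payoff of `u` in the distance-reciprocity balanced (DRB) game. -/
noncomputable def drbPayoff {n k : ℕ} (r : Profile n k) (u : GridNode n k) : ℝ :=
  meanDist u (r u) * reciprocity r u

/-- `s` is a best response of the player `u` to the strategies of the others in `r`. -/
def IsBestResponse {n k : ℕ} (γ : ℝ) (r : Profile n k) (u : GridNode n k) (s : ℝ) : Prop :=
  s ∈ strategySet γ ∧
    ∀ s' ∈ strategySet γ,
      drbPayoff (Function.update r u s') u ≤ drbPayoff (Function.update r u s) u

/-- One synchronous step of the best response dynamic: every player simultaneously moves to a best
response to the current profile `r`, which gives the profile `r'`. -/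
def SyncStep {n k : ℕ} (γ : ℝ) (r r' : Profile n k) : Prop :=
  ∀ u, IsBestResponse γ r u (r' u)

/-- `AsyncRun γ r L r'`: starting at the profile `r`, the players in the list `L` move one after
another (the head of `L` first), each to a best response to the profile that is current at its
move, and the resulting profile is `r'`. -/
inductive AsyncRun {n k : ℕ} (γ : ℝ) :
    Profile n k → List (GridNode n k) → Profile n k → Prop
  | nil (r : Profile n k) : AsyncRun γ r [] r
  | cons {r r' : Profile n k} {u : GridNode n k} {s : ℝ} {L : List (GridNode n k)}
      (hs : IsBestResponse γ r u s) (hL : AsyncRun γ (Function.update r u s) L r') :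
      AsyncRun γ r (u :: L) r'

/-- The navigable small world: every node has connection preference `k`. -/
def navigable (n k : ℕ) : Profile n k := fun _ => (k : ℝ)

/-- One synchronous step of the best response dynamic leads from `r` to the navigable small world,
and to no other profile. -/
def SyncReachesNavigable {n k : ℕ} (γ : ℝ) (r : Profile n k) : Prop :=
  ∀ r' : Profile n k, SyncStep γ r r' ↔ r' = navigable n k

/-- Whatever the order of the moves, as soon as every node has taken at least one asynchronous step,
the best response dynamic that starts at `r` is (possible and) at the navigable small world. -/
def AsyncReachesNavigable {n k : ℕ} (γ : ℝ) (r : Profile n k) : Prop :=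
  ∀ L : List (GridNode n k), (∀ u, u ∈ L) →
    ∀ r' : Profile n k, AsyncRun γ r L r' ↔ r' = navigable n k

/-! Write `c(s)` for `linkNorm u s` and `W(s)` for `linkWeight r u s`. The payoff of `u` at `s` is
`c(s-1)/c(s) * W(s)/c(s)`, and the claim is that `k` strictly beats every other strategy. Since
`c(k)` is polylogarithmic (`linkNorm_dim_le`) and `c(k-1)` is of order at least `n`, the payoff at
`k` is `n^{1-o(1)} W(k)`. For `s ≥ k + γ` links are too short: the mean distance is `n^{1-γ+o(1)}`,
while reciprocity is at most `W(k)`. For `s ≤ k - γ` the mean distance is at most `kn`, but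
reciprocity drops: nodes closer than `n^{1-ε/k}` contribute at most about `n^{-εγ/k} W(k)`, and
farther ones link back with probability `O(n^{ε-k})`, whatever they play. This last term is
negligible only if `W(k)` is not too small, and here the perturbation enters. One node within
`n^{ε/(k+β)}` of `u` playing at least `γ` gives `W(k) ≥ n^{γ-k-ε-o(1)}` (`le_linkWeight_dim`), which
beats `n^{ε-k}` because `2ε < γ`. With high probability every node has such a neighbour, by
independence and a union bound. A move to `k` preserves this condition, so asynchronous runs follow
by induction. -/

/-! ### Geometry of the cycle and the torus. -/

/-- The distance of two residues on the cycle of length `n`. -/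
def cycleDist {n : ℕ} (a b : Fin n) : ℕ :=
  min (((b : ℕ) : ℤ) - ((a : ℕ) : ℤ)).natAbs (n - (((b : ℕ) : ℤ) - ((a : ℕ) : ℤ)).natAbs)

lemma cycleDist_comm {n : ℕ} (a b : Fin n) : cycleDist a b = cycleDist b a := by
  unfold cycleDist
  have : (((b : ℕ) : ℤ) - ((a : ℕ) : ℤ)).natAbs = (((a : ℕ) : ℤ) - ((b : ℕ) : ℤ)).natAbs := by omega
  rw [this]

lemma cycleDist_le {n : ℕ} (a b : Fin n) : cycleDist a b ≤ n := by
  unfold cycleDist; omega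

lemma cycleDist_pos {n : ℕ} {a b : Fin n} (h : a ≠ b) : 1 ≤ cycleDist a b := by
  unfold cycleDist
  have : (a : ℕ) ≠ b := fun h' => h (Fin.ext h')
  omega

lemma gridDist_eq {n k : ℕ} (u v : GridNode n k) :
    gridDist u v = ∑ i, cycleDist (u i) (v i) := rfl

lemma gridDist_comm {n k : ℕ} (u v : GridNode n k) : gridDist u v = gridDist v u := by
  simp only [gridDist_eq, cycleDist_comm]

lemma one_le_gridDist {n k : ℕ} {u v : GridNode n k} (h : v ≠ u) : 1 ≤ gridDist u v := by
  obtain ⟨i, hi⟩ := Function.ne_iff.mp h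
  rw [gridDist_eq]
  exact (cycleDist_pos hi.symm).trans
    (Finset.single_le_sum (f := fun i => cycleDist (u i) (v i)) (fun _ _ => Nat.zero_le _)
      (Finset.mem_univ i))

lemma cycleDist_le_gridDist {n k : ℕ} (u v : GridNode n k) (i : Fin k) :
    cycleDist (u i) (v i) ≤ gridDist u v := by
  rw [gridDist_eq]
  exact Finset.single_le_sum (f := fun i => cycleDist (u i) (v i)) (fun _ _ => Nat.zero_le _)
      (Finset.mem_univ i)

lemma gridDist_le {n k : ℕ} (u v : GridNode n k) : gridDist u v ≤ k * n := by
  rw [gridDist_eq]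
  calc ∑ i, cycleDist (u i) (v i) ≤ ∑ _i : Fin k, n := Finset.sum_le_sum fun i _ => cycleDist_le _ _
    _ = k * n := by simp

/-- Translation of a residue by `a` steps along the cycle. -/
def cycleShift {n : ℕ} (x : Fin n) (a : ℕ) : Fin n :=
  ⟨((x : ℕ) + a) % n, Nat.mod_lt _ x.pos⟩

lemma cycleDist_cycleShift_le {n : ℕ} (x : Fin n) {a : ℕ} (ha : a < n) :
    cycleDist x (cycleShift x a) ≤ a := by
  have hx := x.isLt
  unfold cycleDist cycleShift
  rcases lt_or_ge ((x : ℕ) + a) n with h | h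
  · simp only [Nat.mod_eq_of_lt h]; omega
  · have : ((x : ℕ) + a) % n = x + a - n := by
      rw [Nat.mod_eq_sub_mod h, Nat.mod_eq_of_lt (by omega)]
    simp only [this]; omega

lemma cycleShift_injOn {n : ℕ} (x : Fin n) {a b : ℕ} (ha : a < n) (hb : b < n)
    (h : cycleShift x a = cycleShift x b) : a = b := by
  have h' : ((x : ℕ) + a) ≡ x + b [MOD n] := congrArg Fin.val h
  have := Nat.ModEq.add_left_cancel' _ h'
  rwa [Nat.ModEq, Nat.mod_eq_of_lt ha, Nat.mod_eq_of_lt hb] at this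

lemma cycleShift_zero {n : ℕ} (x : Fin n) : cycleShift x 0 = x := by
  ext; simp [cycleShift, Nat.mod_eq_of_lt x.isLt]

/-- Around every node there are `h ^ k` other nodes at distance at most `k * h`. -/
lemma exists_near_nodes {n k h : ℕ} (hk : 0 < k) (hn : h < n) (u : GridNode n k) :
    ∃ B : Finset (GridNode n k), B.card = h ^ k ∧ ∀ v ∈ B, v ≠ u ∧ gridDist u v ≤ k * h := by
  classical
  -- The `+ 1` keeps every shift nonzero, so the box avoids `u`.
  let f : (Fin k → Fin h) → GridNode n k := fun a i => cycleShift (u i) (a i + 1)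
  have hf : Function.Injective f := fun a b hab => by
    ext i
    have := cycleShift_injOn (u i) (by omega) (by omega) (congrFun hab i)
    omega
  refine ⟨Finset.univ.image f, ?_, ?_⟩
  · rw [Finset.card_image_of_injective _ hf]; simp
  · intro v hv
    obtain ⟨a, -, rfl⟩ := Finset.mem_image.mp hv
    constructor
    · intro heq
      have h0 := congrFun heq ⟨0, hk⟩
      have := cycleShift_injOn (b := 0) (u ⟨0, hk⟩) (a := a ⟨0, hk⟩ + 1) (by omega) (by omega)
        (h0.trans (cycleShift_zero _).symm)
      omega
    · rw [gridDist_eq]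
      calc ∑ i, cycleDist (u i) (f a i) ≤ ∑ _i : Fin k, h := Finset.sum_le_sum fun i _ =>
            (cycleDist_cycleShift_le (u i) (by omega)).trans (by omega)
        _ = k * h := by simp

lemma exists_gridDist_eq_one {n k : ℕ} (hk : 0 < k) (hn : 1 < n) (u : GridNode n k) :
    ∃ v, v ≠ u ∧ gridDist u v = 1 := by
  have hne : cycleShift (u ⟨0, hk⟩) 1 ≠ u ⟨0, hk⟩ := fun h => by
    have := cycleShift_injOn (a := 1) (b := 0) (u ⟨0, hk⟩) hn (by omega)
      (h.trans (cycleShift_zero _).symm)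
    omega
  have hv : Function.update u ⟨0, hk⟩ (cycleShift (u ⟨0, hk⟩) 1) ≠ u := fun h =>
    hne (by simpa using congrFun h ⟨0, hk⟩)
  refine ⟨_, hv, le_antisymm ?_ (one_le_gridDist hv)⟩
  rw [gridDist_eq, Finset.sum_eq_single ⟨0, hk⟩]
  · simpa using cycleDist_cycleShift_le (u ⟨0, hk⟩) hn
  · intro i _ hi
    simp [Function.update_of_ne hi, cycleDist]
  · simp

/-! ### Bounds for the normalization constants. -/

/-- Each offset occurs at most once on either side of `a`, whence the factor 2. -/
lemma sum_natAbs_sub_le {n : ℕ} (a : Fin n) {f : ℕ → ℝ} (hf : ∀ j, 0 ≤ f j) :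
    ∑ b : Fin n, f (((b : ℕ) : ℤ) - ((a : ℕ) : ℤ)).natAbs ≤ 2 * ∑ j ∈ Finset.range n, f j := by
  have key : ∀ s : Finset (Fin n),
      (∀ b ∈ s, ∀ c ∈ s, (((b : ℕ) : ℤ) - ((a : ℕ) : ℤ)).natAbs =
        (((c : ℕ) : ℤ) - ((a : ℕ) : ℤ)).natAbs → b = c) →
      ∑ b ∈ s, f (((b : ℕ) : ℤ) - ((a : ℕ) : ℤ)).natAbs ≤ ∑ j ∈ Finset.range n, f j := by
    intro s hs
    rw [← Finset.sum_image (f := f) (g := fun b : Fin n => (((b : ℕ) : ℤ) - ((a : ℕ) : ℤ)).natAbs)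
      (fun b hb c hc h => hs b hb c hc h)]
    refine Finset.sum_le_sum_of_subset_of_nonneg ?_ fun _ _ _ => hf _
    intro j hj
    obtain ⟨b, -, rfl⟩ := Finset.mem_image.mp hj
    rw [Finset.mem_range]; omega
  rw [← Finset.sum_filter_add_sum_filter_not Finset.univ (fun b : Fin n => b ≤ a), two_mul]
  refine add_le_add (key _ ?_) (key _ ?_)
  · intro b hb c hc h
    simp only [Finset.mem_filter, Finset.mem_univ, true_and, Fin.le_def] at hb hc
    ext; omega
  · intro b hb c hc h
    simp only [Finset.mem_filter, Finset.mem_univ, true_and, Fin.le_def] at hb hc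
    ext; omega

lemma sum_range_inv_le {n : ℕ} :
    ∑ j ∈ Finset.range n, (1 + (j : ℝ))⁻¹ ≤ 1 + Real.log n := by
  have := harmonic_le_one_add_log n
  rw [harmonic] at this
  push_cast at this
  simpa [add_comm] using this

lemma sum_inv_one_add_cycleDist_le {n : ℕ} (a : Fin n) :
    ∑ b : Fin n, (1 + (cycleDist a b : ℝ))⁻¹ ≤ 4 * (1 + Real.log n) := by
  have h1 := sum_natAbs_sub_le a (f := fun j => (1 + (j : ℝ))⁻¹) (fun j => by positivity)
  have h2 := sum_natAbs_sub_le a (f := fun j => (1 + ((n - j : ℕ) : ℝ))⁻¹) (fun j => by positivity)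
  have h3 : ∑ j ∈ Finset.range n, (1 + ((n - j : ℕ) : ℝ))⁻¹ ≤
      ∑ j ∈ Finset.range n, (1 + (j : ℝ))⁻¹ := by
    rw [← Finset.sum_range_reflect (fun j => (1 + (j : ℝ))⁻¹)]
    refine Finset.sum_le_sum fun j hj => ?_
    have : n - 1 - j ≤ n - j := by omega
    gcongr
  have h4 : ∑ b : Fin n, (1 + (cycleDist a b : ℝ))⁻¹ ≤
      ∑ b : Fin n, (1 + ((((b : ℕ) : ℤ) - ((a : ℕ) : ℤ)).natAbs : ℝ))⁻¹ +
      ∑ b : Fin n, (1 + ((n - (((b : ℕ) : ℤ) - ((a : ℕ) : ℤ)).natAbs : ℕ) : ℝ))⁻¹ := by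
    rw [← Finset.sum_add_distrib]
    refine Finset.sum_le_sum fun b _ => ?_
    unfold cycleDist
    rcases min_choice (((b : ℕ) : ℤ) - ((a : ℕ) : ℤ)).natAbs
      (n - (((b : ℕ) : ℤ) - ((a : ℕ) : ℤ)).natAbs) with h | h <;> rw [h]
    · exact le_add_of_nonneg_right (by positivity)
    · exact le_add_of_nonneg_left (by positivity)
  have h5 := sum_range_inv_le (n := n)
  linarith

/-- Each coordinate distance `dᵢ` is at most `d`, and `1 ≤ d`, so `1 + dᵢ ≤ 2d` and `d^{-k} ≤ ∏ 2/(1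
+ dᵢ)`. The sum of the product over all nodes factors into `k` harmonic sums. -/
lemma linkNorm_dim_le {n k : ℕ} (u : GridNode n k) :
    linkNorm u k ≤ (8 * (1 + Real.log n)) ^ k := by
  have hterm : ∀ v ∈ Finset.univ.erase u, (gridDist u v : ℝ) ^ (-(k : ℝ)) ≤
      ∏ i, (2 * (1 + (cycleDist (u i) (v i) : ℝ))⁻¹) := by
    intro v hv
    have hd : (1 : ℝ) ≤ gridDist u v := by
      exact_mod_cast one_le_gridDist (Finset.ne_of_mem_erase hv)
    rw [Real.rpow_neg (by positivity), Real.rpow_natCast, ← inv_pow]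
    calc ((gridDist u v : ℝ)⁻¹) ^ k = ∏ _i : Fin k, (gridDist u v : ℝ)⁻¹ := by simp
      _ ≤ _ := by
        refine Finset.prod_le_prod (fun _ _ => by positivity) fun i _ => ?_
        have : (cycleDist (u i) (v i) : ℝ) ≤ gridDist u v := by
          exact_mod_cast cycleDist_le_gridDist u v i
        rw [inv_le_iff_one_le_mul₀ (by positivity), mul_right_comm, ← div_eq_mul_inv,
          one_le_div (by positivity)]
        linarith
  calc linkNorm u k ≤ ∑ v ∈ Finset.univ.erase u, ∏ i, (2 * (1 + (cycleDist (u i) (v i) : ℝ))⁻¹) :=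
        Finset.sum_le_sum hterm
    _ ≤ ∑ v : GridNode n k, ∏ i, (2 * (1 + (cycleDist (u i) (v i) : ℝ))⁻¹) :=
        Finset.sum_le_sum_of_subset_of_nonneg (Finset.erase_subset _ _)
          fun _ _ _ => Finset.prod_nonneg fun _ _ => by positivity
    _ = ∏ i, ∑ b : Fin n, (2 * (1 + (cycleDist (u i) b : ℝ))⁻¹) := by
        rw [Finset.prod_univ_sum, Fintype.piFinset_univ]
    _ ≤ ∏ _i : Fin k, (8 * (1 + Real.log n)) := by
        refine Finset.prod_le_prod (fun _ _ => Finset.sum_nonneg fun _ _ => by positivity)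
          fun i _ => ?_
        rw [← Finset.mul_sum]
        have := sum_inv_one_add_cycleDist_le (u i)
        linarith
    _ = _ := by simp

lemma one_le_linkNorm {n k : ℕ} (hk : 0 < k) (hn : 1 < n) (u : GridNode n k) (s : ℝ) :
    1 ≤ linkNorm u s := by
  obtain ⟨v, hv, hd⟩ := exists_gridDist_eq_one hk hn u
  have := Finset.single_le_sum (s := Finset.univ.erase u)
    (f := fun v => (gridDist u v : ℝ) ^ (-s)) (fun _ _ => by positivity)
    (Finset.mem_erase.mpr ⟨hv, Finset.mem_univ v⟩)
  rw [hd, Nat.cast_one, Real.one_rpow] at this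
  exact this

lemma linkNorm_pos {n k : ℕ} (hk : 0 < k) (hn : 1 < n) (u : GridNode n k) (s : ℝ) :
    0 < linkNorm u s := zero_lt_one.trans_le (one_le_linkNorm hk hn u s)

lemma linkNorm_ge {n k : ℕ} (hk : 0 < k) (hn : 1 < n) (u : GridNode n k) {s : ℝ} (hs : 0 ≤ s) :
    (n : ℝ) ^ (k : ℝ) / 2 * ((k : ℝ) * n) ^ (-s) ≤ linkNorm u s := by
  have hcard : ((Finset.univ.erase u).card : ℝ) = (n : ℝ) ^ k - 1 := by
    rw [Finset.card_erase_of_mem (Finset.mem_univ u)]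
    simp only [Finset.card_univ, Fintype.card_fun, Fintype.card_fin]
    rw [Nat.cast_sub (Nat.one_le_pow _ _ (by omega))]; simp
  have hpow : (2 : ℝ) ≤ (n : ℝ) ^ k := by
    have h2 : 2 ≤ n := hn
    exact_mod_cast h2.trans (Nat.le_self_pow hk.ne' n)
  have hsum : (Finset.univ.erase u).card • ((k : ℝ) * n) ^ (-s) ≤ linkNorm u s := by
    refine Finset.card_nsmul_le_sum _ _ _ fun v hv => ?_
    have hd : (1 : ℝ) ≤ gridDist u v := by
      exact_mod_cast one_le_gridDist (Finset.ne_of_mem_erase hv)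
    refine Real.rpow_le_rpow_of_nonpos (by positivity) ?_ (by linarith)
    exact_mod_cast gridDist_le u v
  rw [nsmul_eq_mul, hcard] at hsum
  refine le_trans ?_ hsum
  rw [Real.rpow_natCast]
  gcongr
  linarith

lemma linkNorm_le_of_le {n k : ℕ} (u : GridNode n k) {s t : ℝ} (hst : s ≤ t) :
    linkNorm u s ≤ ((k : ℝ) * n) ^ (t - s) * linkNorm u t := by
  unfold linkNorm
  rw [Finset.mul_sum]
  refine Finset.sum_le_sum fun v hv => ?_
  have hd : (1 : ℝ) ≤ gridDist u v := by
    exact_mod_cast one_le_gridDist (Finset.ne_of_mem_erase hv)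
  have hd' : (gridDist u v : ℝ) ≤ k * n := by exact_mod_cast gridDist_le u v
  rw [show -s = (t - s) + -t by ring, Real.rpow_add (by linarith)]
  gcongr

lemma linkNorm_anti {n k : ℕ} (u : GridNode n k) {s t : ℝ} (hst : s ≤ t) :
    linkNorm u t ≤ linkNorm u s := by
  refine Finset.sum_le_sum fun v hv => ?_
  have hd : (1 : ℝ) ≤ gridDist u v := by
    exact_mod_cast one_le_gridDist (Finset.ne_of_mem_erase hv)
  exact Real.rpow_le_rpow_of_exponent_le hd (by linarith)

/-! ### Payoff estimates for a single player. -/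

/-- The reciprocity of `u`, up to normalization, if `u` moves to `s` in the profile `r`. -/
noncomputable def linkWeight {n k : ℕ} (r : Profile n k) (u : GridNode n k) (s : ℝ) : ℝ :=
  ∑ v ∈ Finset.univ.erase u, (gridDist u v : ℝ) ^ (-s) * linkProb v u (r v)

lemma linkProb_nonneg {n k : ℕ} (u v : GridNode n k) (s : ℝ) : 0 ≤ linkProb u v s := by
  unfold linkProb linkNorm; positivity

lemma linkWeight_nonneg {n k : ℕ} (r : Profile n k) (u : GridNode n k) (s : ℝ) :
    0 ≤ linkWeight r u s :=
  Finset.sum_nonneg fun v _ => mul_nonneg (by positivity) (linkProb_nonneg v u _)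

lemma linkWeight_anti {n k : ℕ} (r : Profile n k) (u : GridNode n k) {s t : ℝ} (hst : s ≤ t) :
    linkWeight r u t ≤ linkWeight r u s := by
  refine Finset.sum_le_sum fun v hv => mul_le_mul_of_nonneg_right ?_ (linkProb_nonneg v u _)
  have hd : (1 : ℝ) ≤ gridDist u v := by
    exact_mod_cast one_le_gridDist (Finset.ne_of_mem_erase hv)
  exact Real.rpow_le_rpow_of_exponent_le hd (by linarith)

lemma meanDist_eq {n k : ℕ} (u : GridNode n k) (s : ℝ) :
    meanDist u s = linkNorm u (s - 1) / linkNorm u s := by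
  rw [linkNorm, Finset.sum_div]
  unfold meanDist linkProb
  refine Finset.sum_congr rfl fun v hv => ?_
  have hd : (1 : ℝ) ≤ gridDist u v := by
    exact_mod_cast one_le_gridDist (Finset.ne_of_mem_erase hv)
  rw [show -(s - 1) = -s + 1 by ring, Real.rpow_add_one (by positivity)]
  ring

lemma reciprocity_update {n k : ℕ} (r : Profile n k) (u : GridNode n k) (s : ℝ) :
    reciprocity (Function.update r u s) u = linkWeight r u s / linkNorm u s := by
  unfold reciprocity linkWeight
  rw [Finset.sum_div]
  refine Finset.sum_congr rfl fun v hv => ?_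
  rw [Function.update_self, Function.update_of_ne (Finset.ne_of_mem_erase hv), linkProb]
  ring

lemma drbPayoff_update {n k : ℕ} (r : Profile n k) (u : GridNode n k) (s : ℝ) :
    drbPayoff (Function.update r u s) u =
      linkNorm u (s - 1) / linkNorm u s * (linkWeight r u s / linkNorm u s) := by
  rw [drbPayoff, reciprocity_update, Function.update_self, meanDist_eq]

lemma meanDist_le {n k : ℕ} (hk : 0 < k) (hn : 1 < n) (u : GridNode n k) (s : ℝ) :
    meanDist u s ≤ k * n := by
  rw [meanDist_eq, div_le_iff₀ (linkNorm_pos hk hn u s)]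
  simpa using linkNorm_le_of_le u (show s - 1 ≤ s by linarith)

/-- If `t ≤ k`, the normalization constant is at least of order `n^{k-t}` and compensates for a
small `t`. If `t ≥ k`, the numerator alone is at most `n^{-(1-ε/k)k} = n^{ε-k}`. -/
lemma linkProb_le_of_far {n k : ℕ} (hk : 0 < k) (hn : 1 < n) {ε : ℝ} (hε : 0 ≤ ε)
    {u v : GridNode n k} (hd : (n : ℝ) ^ (1 - ε / k) ≤ gridDist u v) (hεk : ε ≤ k)
    {t : ℝ} (ht : 0 ≤ t) :
    linkProb v u t ≤ 2 * (k : ℝ) ^ (k : ℝ) * (n : ℝ) ^ (ε - k) := by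
  have hk1 : (1 : ℝ) ≤ k := by exact_mod_cast hk
  have hn1 : (1 : ℝ) ≤ n := by exact_mod_cast hn.le
  have hn0 : (0 : ℝ) < n := by linarith
  have hk0 : (0 : ℝ) < k := by linarith
  have hdt : (gridDist v u : ℝ) ^ (-t) ≤ (n : ℝ) ^ ((1 - ε / k) * -t) := by
    rw [Real.rpow_mul hn0.le, gridDist_comm]
    exact Real.rpow_le_rpow_of_nonpos (by positivity) hd (by linarith)
  have hεk' : ε / k ≤ 1 := (div_le_one hk0).mpr hεk
  have hkk : (1 : ℝ) ≤ (k : ℝ) ^ (k : ℝ) := Real.one_le_rpow hk1 hk0.le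
  rw [linkProb, div_le_iff₀ (linkNorm_pos hk hn v t)]
  refine hdt.trans ?_
  rcases le_total t k with htk | htk
  · calc (n : ℝ) ^ ((1 - ε / k) * -t)
        ≤ ((k : ℝ) ^ ((k : ℝ) - t)) * (n : ℝ) ^ (ε - t) := by
          refine le_trans ?_ (le_mul_of_one_le_left (by positivity)
            (Real.one_le_rpow hk1 (by linarith)))
          refine Real.rpow_le_rpow_of_exponent_le hn1 ?_
          have : ε / k * t ≤ ε := by
            rw [div_mul_eq_mul_div, div_le_iff₀ hk0]; gcongr
          linarith
      _ = 2 * (k : ℝ) ^ (k : ℝ) * (n : ℝ) ^ (ε - k) *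
          ((n : ℝ) ^ (k : ℝ) / 2 * ((k : ℝ) * n) ^ (-t)) := by
          rw [Real.mul_rpow hk0.le hn0.le, sub_eq_add_neg, Real.rpow_add hk0,
            show ε - t = (ε - k) + k + -t by ring, Real.rpow_add hn0, Real.rpow_add hn0]
          ring
      _ ≤ _ := by
          gcongr
          exact linkNorm_ge hk hn v ht
  · calc (n : ℝ) ^ ((1 - ε / k) * -t) ≤ (n : ℝ) ^ (ε - k) := by
          refine Real.rpow_le_rpow_of_exponent_le hn1 ?_
          have h1 : (1 - ε / k) * k ≤ (1 - ε / k) * t :=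
            mul_le_mul_of_nonneg_left htk (by linarith)
          have h2 : (1 - ε / k) * k = k - ε := by field_simp
          linarith
      _ ≤ 2 * (k : ℝ) ^ (k : ℝ) * (n : ℝ) ^ (ε - k) := by
          refine le_mul_of_one_le_left (by positivity) (by linarith)
      _ ≤ _ := le_mul_of_one_le_right (by positivity) (one_le_linkNorm hk hn v t)

/-- The loss `(kn)^{γ-k}` comes from the worst case `t = γ`, where the normalization constant may be
as large as `(kn)^{k-γ} E`. The alternative `t = k` covers nodes that have already moved, as `k` may
exceed `β`. -/
lemma le_linkProb {n k : ℕ} (hk : 0 < k) (hn : 1 < n) {γ β E : ℝ} (hγβ : γ ≤ β) (hγk : γ ≤ k)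
    {u v : GridNode n k} (huv : v ≠ u) (hE : linkNorm v k ≤ E)
    {t : ℝ} (hγt : γ ≤ t) (ht : t ≤ β ∨ t = k) :
    (gridDist u v : ℝ) ^ (-β) * ((k : ℝ) * n) ^ (γ - k) / E ≤ linkProb v u t := by
  have hk1 : (1 : ℝ) ≤ k := by exact_mod_cast hk
  have hn1 : (1 : ℝ) ≤ n := by exact_mod_cast hn.le
  have hkn : (1 : ℝ) ≤ (k : ℝ) * n := one_le_mul_of_one_le_of_one_le hk1 hn1
  have hd : (1 : ℝ) ≤ gridDist u v := by exact_mod_cast one_le_gridDist huv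
  have hd' : (gridDist u v : ℝ) ≤ k * n := by exact_mod_cast gridDist_le u v
  have hE1 : 1 ≤ E := (one_le_linkNorm hk hn v k).trans hE
  rw [linkProb, gridDist_comm v u, div_le_div_iff₀ (by linarith) (linkNorm_pos hk hn v t)]
  set d : ℝ := (gridDist u v : ℝ)
  rcases le_or_gt t k with htk | htk
  · have h1 : linkNorm v t ≤ ((k : ℝ) * n) ^ ((k : ℝ) - t) * E :=
      (linkNorm_le_of_le v htk).trans (by gcongr)
    have h2 : d ^ (-β) ≤ d ^ (-t) * ((k : ℝ) * n) ^ (t - γ) := by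
      calc d ^ (-β) ≤ d ^ (-γ) := Real.rpow_le_rpow_of_exponent_le hd (by linarith)
        _ = d ^ (-t) * d ^ (t - γ) := by rw [← Real.rpow_add (by linarith)]; ring_nf
        _ ≤ _ := by gcongr
    have hc := (linkNorm_pos hk hn v t).le
    calc d ^ (-β) * ((k : ℝ) * n) ^ (γ - k) * linkNorm v t
        ≤ (d ^ (-t) * ((k : ℝ) * n) ^ (t - γ)) * ((k : ℝ) * n) ^ (γ - k) *
          (((k : ℝ) * n) ^ ((k : ℝ) - t) * E) := by gcongr
      _ = d ^ (-t) * E * (((k : ℝ) * n) ^ (t - γ) * ((k : ℝ) * n) ^ (γ - k) *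
          (((k : ℝ) * n) ^ ((k : ℝ) - t))) := by ring
      _ = d ^ (-t) * E := by
          rw [← Real.rpow_add (by linarith), ← Real.rpow_add (by linarith),
            show t - γ + (γ - k) + (k - t) = 0 by ring, Real.rpow_zero, mul_one]
  · have htβ : t ≤ β := ht.resolve_right htk.ne'
    have hc := (linkNorm_pos hk hn v t).le
    calc d ^ (-β) * ((k : ℝ) * n) ^ (γ - k) * linkNorm v t ≤ d ^ (-t) * 1 * E := by
          gcongr
          · exact Real.rpow_le_one_of_one_le_of_nonpos hkn (by linarith)
          · exact (linkNorm_anti v htk.le).trans hE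
      _ = _ := by ring

/-- A lower bound for the payoff of the strategy `k`. -/
lemma le_drbPayoff_dim {n k : ℕ} (hk : 0 < k) (hn : 1 < n) (r : Profile n k) (u : GridNode n k)
    {E : ℝ} (hE : linkNorm u k ≤ E) :
    n / (2 * (k : ℝ) ^ ((k : ℝ) - 1)) / E ^ 2 * linkWeight r u k ≤
      drbPayoff (Function.update r u (k : ℝ)) u := by
  have hk1 : (1 : ℝ) ≤ k := by exact_mod_cast hk
  have hn0 : (0 : ℝ) < n := by exact_mod_cast (by omega : 0 < n)
  have hc := linkNorm_pos hk hn u k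
  have h := linkNorm_ge hk hn u (s := (k : ℝ) - 1) (by linarith)
  have h' : n / (2 * (k : ℝ) ^ ((k : ℝ) - 1)) ≤ linkNorm u ((k : ℝ) - 1) := by
    refine le_trans (le_of_eq ?_) h
    rw [Real.mul_rpow (by linarith) hn0.le, Real.rpow_neg (by linarith),
      show -((k : ℝ) - 1) = 1 + -k by ring, Real.rpow_add hn0, Real.rpow_neg hn0.le, Real.rpow_one]
    have := (Real.rpow_pos_of_pos hn0 (k : ℝ)).ne'
    field_simp
  rw [drbPayoff_update]
  calc n / (2 * (k : ℝ) ^ ((k : ℝ) - 1)) / E ^ 2 * linkWeight r u k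
      ≤ linkNorm u ((k : ℝ) - 1) / (linkNorm u k) ^ 2 * linkWeight r u k := by
        gcongr
        · exact linkWeight_nonneg r u k
        · exact (linkNorm_pos hk hn u _).le
    _ = _ := by field_simp

/-- Both denominators are at least 1 and can be dropped; `c(s-1) ≤ c(k+γ-1)` is within a factor
`(kn)^{1-γ}` of `c(k)`. -/
lemma drbPayoff_le_of_dim_lt {n k : ℕ} (hk : 0 < k) (hn : 1 < n) (r : Profile n k)
    (u : GridNode n k) {γ s E : ℝ} (hγ0 : 0 ≤ γ) (hγ : γ ≤ 1) (hs : k + γ ≤ s)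
    (hE : linkNorm u k ≤ E) :
    drbPayoff (Function.update r u s) u ≤ ((k : ℝ) * n) ^ (1 - γ) * E * linkWeight r u k := by
  rw [drbPayoff_update]
  have h0 := linkNorm_pos hk hn u (s - 1)
  have hW := linkWeight_nonneg r u s
  calc linkNorm u (s - 1) / linkNorm u s * (linkWeight r u s / linkNorm u s)
      ≤ linkNorm u (s - 1) * linkWeight r u s := by
        have h1 := one_le_linkNorm hk hn u s
        gcongr
        · exact div_le_self h0.le h1
        · exact div_le_self hW h1
    _ ≤ (((k : ℝ) * n) ^ (1 - γ) * E) * linkWeight r u k := by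
        refine mul_le_mul ?_ (linkWeight_anti r u (by linarith)) hW
          (mul_nonneg (by positivity) ((linkNorm_pos hk hn u k).le.trans hE))
        · calc linkNorm u (s - 1) ≤ linkNorm u (k + γ - 1) := linkNorm_anti u (by linarith)
            _ ≤ ((k : ℝ) * n) ^ ((k : ℝ) - (k + γ - 1)) * linkNorm u k :=
                linkNorm_le_of_le u (by linarith)
            _ = ((k : ℝ) * n) ^ (1 - γ) * linkNorm u k := by ring_nf
            _ ≤ _ := by gcongr

lemma drbPayoff_le_of_lt_dim {n k : ℕ} (hk : 0 < k) (hn : 1 < n) {r : Profile n k}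
    (hr : ∀ v, 0 ≤ r v) (u : GridNode n k) {γ ε s : ℝ} (hγ : 0 ≤ γ) (hε : 0 ≤ ε) (hεk : ε ≤ k)
    (hs0 : 0 ≤ s) (hs : s ≤ k - γ) :
    drbPayoff (Function.update r u s) u ≤
      2 * (k : ℝ) ^ ((k : ℝ) + 1) * (n : ℝ) ^ (1 - ε / k * γ) * linkWeight r u k +
      2 * (k : ℝ) ^ ((k : ℝ) + 1) * (n : ℝ) ^ (1 + ε - k) := by
  have hk1 : (1 : ℝ) ≤ k := by exact_mod_cast hk
  have hn1 : (1 : ℝ) ≤ n := by exact_mod_cast hn.le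
  have hn0 : (0 : ℝ) < n := by linarith
  have hk0 : (0 : ℝ) < k := by linarith
  have hc := linkNorm_pos hk hn u s
  have hterm : ∀ v ∈ Finset.univ.erase u,
      (gridDist u v : ℝ) ^ (-s) * linkProb v u (r v) ≤
      2 * (k : ℝ) ^ (k : ℝ) * (n : ℝ) ^ (-(ε / k * γ)) * linkNorm u s *
        ((gridDist u v : ℝ) ^ (-(k : ℝ)) * linkProb v u (r v)) +
      2 * (k : ℝ) ^ (k : ℝ) * (n : ℝ) ^ (ε - k) * (gridDist u v : ℝ) ^ (-s) := by
    intro v hv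
    have hd : (1 : ℝ) ≤ gridDist u v := by
      exact_mod_cast one_le_gridDist (Finset.ne_of_mem_erase hv)
    have hp := linkProb_nonneg v u (r v)
    -- Near nodes: passing from `d^{-k}` to `d^{-s}` costs `d^{k-s}`, which falls short of the gain
    -- `n^{k-s}` in `c(s)` by `n^{-(ε/k)(k-s)} ≤ n^{-εγ/k}`. Far nodes: the probability of the link
    -- back is small.
    rcases le_total (gridDist u v : ℝ) ((n : ℝ) ^ (1 - ε / k)) with h | h
    · refine le_add_of_le_of_nonneg ?_ (by positivity)
      rw [← mul_assoc]
      refine mul_le_mul_of_nonneg_right ?_ hp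
      calc (gridDist u v : ℝ) ^ (-s)
          = (gridDist u v : ℝ) ^ ((k : ℝ) - s) * (gridDist u v : ℝ) ^ (-(k : ℝ)) := by
            rw [← Real.rpow_add (by linarith)]; ring_nf
        _ ≤ ((k : ℝ) ^ ((k : ℝ) - s) * (n : ℝ) ^ ((1 - ε / k) * (k - s))) *
              (gridDist u v : ℝ) ^ (-(k : ℝ)) := by
            gcongr
            rw [Real.rpow_mul hn0.le]
            refine le_trans ?_ (le_mul_of_one_le_left (by positivity)
              (Real.one_le_rpow hk1 (by linarith)))
            exact Real.rpow_le_rpow (by positivity) h (by linarith)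
        _ ≤ (2 * (k : ℝ) ^ (k : ℝ) * (n : ℝ) ^ (-(ε / k * γ)) * linkNorm u s) *
              (gridDist u v : ℝ) ^ (-(k : ℝ)) := by
            refine mul_le_mul_of_nonneg_right ?_ (by positivity)
            calc (k : ℝ) ^ ((k : ℝ) - s) * (n : ℝ) ^ ((1 - ε / k) * (k - s))
                ≤ (k : ℝ) ^ ((k : ℝ) - s) * (n : ℝ) ^ (-(ε / k * γ) + (k - s)) := by
                  refine mul_le_mul_of_nonneg_left ?_ (by positivity)
                  refine Real.rpow_le_rpow_of_exponent_le hn1 ?_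
                  have : ε / k * γ ≤ ε / k * (k - s) :=
                    mul_le_mul_of_nonneg_left (by linarith) (by positivity)
                  linarith
              _ = 2 * (k : ℝ) ^ (k : ℝ) * (n : ℝ) ^ (-(ε / k * γ)) *
                  ((n : ℝ) ^ (k : ℝ) / 2 * ((k : ℝ) * n) ^ (-s)) := by
                  rw [Real.mul_rpow hk0.le hn0.le, sub_eq_add_neg, Real.rpow_add hk0,
                    Real.rpow_add hn0, Real.rpow_add hn0]
                  ring
              _ ≤ _ := by
                  exact mul_le_mul_of_nonneg_left (linkNorm_ge hk hn u hs0) (by positivity)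
    · refine le_add_of_nonneg_of_le (by positivity) ?_
      rw [mul_comm]
      gcongr
      exact linkProb_le_of_far hk hn hε h hεk (hr v)
  have hsum := Finset.sum_le_sum hterm
  rw [Finset.sum_add_distrib, ← Finset.mul_sum, ← Finset.mul_sum] at hsum
  change linkWeight r u s ≤ _ * linkWeight r u k + _ * linkNorm u s at hsum
  have hR : linkWeight r u s / linkNorm u s ≤
      2 * (k : ℝ) ^ (k : ℝ) * (n : ℝ) ^ (-(ε / k * γ)) * linkWeight r u k +
      2 * (k : ℝ) ^ (k : ℝ) * (n : ℝ) ^ (ε - k) := by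
    rw [div_le_iff₀ hc]; linarith
  rw [drbPayoff_update, ← meanDist_eq]
  have hW := linkWeight_nonneg r u k
  calc meanDist u s * (linkWeight r u s / linkNorm u s) ≤ (k * n) *
      (2 * (k : ℝ) ^ (k : ℝ) * (n : ℝ) ^ (-(ε / k * γ)) * linkWeight r u k +
      2 * (k : ℝ) ^ (k : ℝ) * (n : ℝ) ^ (ε - k)) := by
        gcongr
        · exact div_nonneg (linkWeight_nonneg r u s) hc.le
        · exact meanDist_le hk hn u s
    _ = _ := by
        rw [Real.rpow_add_one hk0.ne', sub_eq_add_neg 1, Real.rpow_add hn0, add_sub_assoc,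
          Real.rpow_add hn0, Real.rpow_one]
        ring

/-! ### The invariant of the dynamic and the strict dominance of `k`. -/

/-- Every player has a player with a positive connection preference within distance `ρ`. -/
def LocallyPerturbed {n k : ℕ} (γ β ρ : ℝ) (r : Profile n k) : Prop :=
  (∀ v, 0 ≤ r v) ∧
    ∀ u, ∃ v, v ≠ u ∧ (gridDist u v : ℝ) ≤ ρ ∧ γ ≤ r v ∧ (r v ≤ β ∨ r v = k)

lemma LocallyPerturbed.update {n k : ℕ} {γ β ρ : ℝ} {r : Profile n k}
    (h : LocallyPerturbed γ β ρ r) (hγ : γ ≤ k) (u : GridNode n k) :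
    LocallyPerturbed γ β ρ (Function.update r u (k : ℝ)) := by
  refine ⟨fun v => ?_, fun w => ?_⟩
  · rcases eq_or_ne v u with rfl | hv
    · simp
    · simpa [hv] using h.1 v
  · obtain ⟨v, hv, hd, h1, h2⟩ := h.2 w
    refine ⟨v, hv, hd, ?_⟩
    rcases eq_or_ne v u with rfl | hvu
    · simpa using hγ
    · simpa [hvu] using ⟨h1, h2⟩

lemma le_linkWeight_dim {n k : ℕ} (hk : 0 < k) (hn : 1 < n) {γ β ε E : ℝ} (hγ : 0 ≤ γ)
    (hγβ : γ ≤ β) (hγk : γ ≤ k) {r : Profile n k}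
    (hr : LocallyPerturbed γ β ((n : ℝ) ^ (ε / (k + β))) r) (u : GridNode n k)
    (hE : ∀ v : GridNode n k, linkNorm v k ≤ E) :
    (n : ℝ) ^ (-ε) * ((k : ℝ) * n) ^ (γ - k) / E ≤ linkWeight r u k := by
  obtain ⟨v, hv, hd, h1, h2⟩ := hr.2 u
  have hk0 : (0 : ℝ) < k := by exact_mod_cast hk
  have hd1 : (1 : ℝ) ≤ gridDist u v := by exact_mod_cast one_le_gridDist hv
  have hE1 : 1 ≤ E := (one_le_linkNorm hk hn v k).trans (hE v)
  have hsingle := Finset.single_le_sum (s := Finset.univ.erase u)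
    (f := fun v => (gridDist u v : ℝ) ^ (-(k : ℝ)) * linkProb v u (r v))
    (fun v _ => mul_nonneg (by positivity) (linkProb_nonneg v u _))
    (Finset.mem_erase.mpr ⟨hv, Finset.mem_univ v⟩)
  refine le_trans ?_ hsingle
  calc (n : ℝ) ^ (-ε) * ((k : ℝ) * n) ^ (γ - k) / E
      ≤ (gridDist u v : ℝ) ^ (-(k : ℝ) + -β) * ((k : ℝ) * n) ^ (γ - k) / E := by
        gcongr
        -- The radius is chosen so that its power `-(k+β)` is exactly `n^{-ε}`: `k` from the link of
        -- `u`, `β` from the link back.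
        calc (n : ℝ) ^ (-ε) = ((n : ℝ) ^ (ε / (k + β))) ^ (-(k : ℝ) + -β) := by
              rw [← Real.rpow_mul (by positivity)]
              congr 1
              have : (k : ℝ) + β ≠ 0 := by linarith
              field_simp
              ring
          _ ≤ _ := Real.rpow_le_rpow_of_nonpos (by linarith) hd (by linarith)
    _ = (gridDist u v : ℝ) ^ (-(k : ℝ)) *
        ((gridDist u v : ℝ) ^ (-β) * ((k : ℝ) * n) ^ (γ - k) / E) := by
        rw [Real.rpow_add (by linarith)]; ring
    _ ≤ _ := by
        gcongr
        exact le_linkProb hk hn hγβ hγk hv (hE v) h1 h2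

/-- The growth conditions on the size `n` of the grid under which the strategy `k` strictly
dominates, where `E` bounds the normalization constants. -/
structure LargeGrid (n k : ℕ) (γ ε E : ℝ) : Prop where
  one_lt : 1 < n
  linkNorm_le : ∀ u : GridNode n k, linkNorm u k ≤ E
  above : ((k : ℝ) * n) ^ (1 - γ) * E < n / (2 * (k : ℝ) ^ ((k : ℝ) - 1)) / E ^ 2
  near : 2 * (k : ℝ) ^ ((k : ℝ) + 1) * (n : ℝ) ^ (1 - ε / k * γ) ≤
    n / (2 * (k : ℝ) ^ ((k : ℝ) - 1)) / E ^ 2 / 2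
  far : 2 * (k : ℝ) ^ ((k : ℝ) + 1) * (n : ℝ) ^ (1 + ε - k) <
    n / (2 * (k : ℝ) ^ ((k : ℝ) - 1)) / E ^ 2 / 2 *
      ((n : ℝ) ^ (-ε) * ((k : ℝ) * n) ^ (γ - k) / E)

section BestResponse

variable {n k : ℕ} {γ β ε E : ℝ}

lemma drbPayoff_lt (hN : LargeGrid n k γ ε E) (hk : 0 < k) (hγ : 0 ≤ γ) (hγ1 : γ ≤ 1)
    (hγβ : γ ≤ β) (hε : 0 ≤ ε) (hεk : ε ≤ k) {r : Profile n k}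
    (hr : LocallyPerturbed γ β ((n : ℝ) ^ (ε / (k + β))) r) (u : GridNode n k) {s : ℝ}
    (hs0 : 0 ≤ s) (hs : s ≤ k - γ ∨ k + γ ≤ s) :
    drbPayoff (Function.update r u s) u < drbPayoff (Function.update r u (k : ℝ)) u := by
  have hn := hN.one_lt
  have hk0 : (0 : ℝ) < k := by exact_mod_cast hk
  have hk1 : (1 : ℝ) ≤ k := by exact_mod_cast hk
  have hn0 : (0 : ℝ) < n := by exact_mod_cast (by omega : 0 < n)
  have hE1 : 1 ≤ E := (one_le_linkNorm hk hn u k).trans (hN.linkNorm_le u)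
  have hlow := le_linkWeight_dim hk hn hγ hγβ (hγ1.trans hk1) hr u hN.linkNorm_le
  have hW : 0 < linkWeight r u k := lt_of_lt_of_le (by positivity) hlow
  refine lt_of_lt_of_le ?_ (le_drbPayoff_dim hk hn r u (hN.linkNorm_le u))
  rcases hs with hs | hs
  · refine (drbPayoff_le_of_lt_dim hk hn hr.1 u hγ hε hεk hs0 hs).trans_lt ?_
    set a := n / (2 * (k : ℝ) ^ ((k : ℝ) - 1)) / E ^ 2 with ha
    have ha0 : 0 < a := by positivity
    have h1 := mul_le_mul_of_nonneg_right hN.near hW.le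
    have h2 := hN.far.trans_le
      (mul_le_mul_of_nonneg_left hlow (by rw [← ha]; positivity))
    rw [← ha] at h1 h2
    linarith
  · refine (drbPayoff_le_of_dim_lt hk hn r u hγ hγ1 hs (hN.linkNorm_le u)).trans_lt ?_
    exact mul_lt_mul_of_pos_right hN.above hW

/-- As `γ = 1/g`, the strategy `k` is the multiple `kg` of `γ`, and every other strategy differs
from it by at least `γ`. -/
lemma isBestResponse_iff (hN : LargeGrid n k γ ε E) (hk : 0 < k)
    (hγ : ∃ g : ℕ, 2 ≤ g ∧ γ = 1 / (g : ℝ)) (hγβ : γ ≤ β) (hε : 0 ≤ ε) (hεk : ε ≤ k)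
    {r : Profile n k} (hr : LocallyPerturbed γ β ((n : ℝ) ^ (ε / (k + β))) r)
    (u : GridNode n k) (s : ℝ) : IsBestResponse γ r u s ↔ s = k := by
  obtain ⟨g, hg, rfl⟩ := hγ
  have hg0 : (0 : ℝ) < g := by exact_mod_cast (by omega : 0 < g)
  have hg1 : 1 / (g : ℝ) ≤ 1 := by
    rw [div_le_one hg0]; exact_mod_cast (by omega : 1 ≤ g)
  have hmem : (k : ℝ) ∈ strategySet (1 / (g : ℝ)) :=
    ⟨k * g, by push_cast; field_simp⟩
  have hlt : ∀ s ∈ strategySet (1 / (g : ℝ)), s ≠ k →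
      drbPayoff (Function.update r u s) u < drbPayoff (Function.update r u (k : ℝ)) u := by
    rintro s ⟨m, rfl⟩ hs
    have hm : m ≠ k * g := fun h => hs (by rw [h]; push_cast; field_simp)
    refine drbPayoff_lt hN hk (by positivity) hg1 hγβ hε hεk hr u (by positivity) ?_
    have hkg : (k : ℝ) = (k * g : ℕ) * (1 / (g : ℝ)) := by push_cast; field_simp
    rcases lt_or_gt_of_ne hm with h | h
    · left
      have : (m : ℝ) + 1 ≤ (k * g : ℕ) := by exact_mod_cast h
      rw [hkg, ← sub_one_mul]
      gcongr
      linarith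
    · right
      have : ((k * g : ℕ) : ℝ) + 1 ≤ m := by exact_mod_cast h
      nth_rewrite 1 [hkg]
      rw [← add_one_mul]
      gcongr
  constructor
  · intro h
    by_contra hs
    exact (hlt s h.1 hs).not_ge (h.2 k hmem)
  · rintro rfl
    refine ⟨hmem, fun s hs => ?_⟩
    rcases eq_or_ne s k with rfl | h
    · exact le_rfl
    · exact (hlt s hs h).le

lemma syncReachesNavigable (hN : LargeGrid n k γ ε E) (hk : 0 < k)
    (hγ : ∃ g : ℕ, 2 ≤ g ∧ γ = 1 / (g : ℝ)) (hγβ : γ ≤ β) (hε : 0 ≤ ε) (hεk : ε ≤ k)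
    {r : Profile n k} (hr : LocallyPerturbed γ β ((n : ℝ) ^ (ε / (k + β))) r) :
    SyncReachesNavigable γ r := fun r' => by
  simp only [SyncStep, isBestResponse_iff hN hk hγ hγβ hε hεk hr, navigable, funext_iff]

lemma asyncRun_iff (hN : LargeGrid n k γ ε E) (hk : 0 < k)
    (hγ : ∃ g : ℕ, 2 ≤ g ∧ γ = 1 / (g : ℝ)) (hγβ : γ ≤ β) (hε : 0 ≤ ε) (hεk : ε ≤ k)
    (hγk : γ ≤ k) (L : List (GridNode n k)) (r r' : Profile n k)
    (hr : LocallyPerturbed γ β ((n : ℝ) ^ (ε / (k + β))) r) :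
    AsyncRun γ r L r' ↔ r' = fun v => if v ∈ L then (k : ℝ) else r v := by
  induction L generalizing r with
  | nil =>
    constructor
    · rintro ⟨⟩; simp
    · intro h
      have : r' = r := by simpa using h
      rw [this]
      exact AsyncRun.nil r
  | cons u L ih =>
    have hbr := isBestResponse_iff hN hk hγ hγβ hε hεk hr u
    have hu := ih (Function.update r u (k : ℝ)) (hr.update hγk u)
    -- A node already at `k` stays there on later moves, so only membership in the list matters.
    have heq : (fun v => if v ∈ L then (k : ℝ) else Function.update r u (k : ℝ) v) =
        fun v => if v ∈ u :: L then (k : ℝ) else r v := by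
      ext v
      rcases eq_or_ne v u with rfl | hv
      · simp
      · simp [hv]
    rw [heq] at hu
    rw [← hu]
    constructor
    · intro h
      cases h with
      | cons hs hL => rwa [(hbr _).mp hs] at hL
    · exact fun h => AsyncRun.cons ((hbr _).mpr rfl) h

lemma asyncReachesNavigable (hN : LargeGrid n k γ ε E) (hk : 0 < k)
    (hγ : ∃ g : ℕ, 2 ≤ g ∧ γ = 1 / (g : ℝ)) (hγβ : γ ≤ β) (hε : 0 ≤ ε) (hεk : ε ≤ k)
    (hγk : γ ≤ k) {r : Profile n k}
    (hr : LocallyPerturbed γ β ((n : ℝ) ^ (ε / (k + β))) r) :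
    AsyncReachesNavigable γ r := fun L hL r' => by
  rw [asyncRun_iff hN hk hγ hγβ hε hεk hγk L r r' hr]
  simp only [hL, if_true]
  rfl

end BestResponse

/-! ### Growth comparison for large `n`. -/

section Asymptotics

open Filter Topology

lemma eventually_mul_rpow_lt (C : ℝ) {a b : ℝ} (hab : a < b) :
    ∀ᶠ n : ℕ in atTop, C * (n : ℝ) ^ a < (n : ℝ) ^ b := by
  have h := ((tendsto_rpow_atTop (sub_pos.mpr hab)).comp
    tendsto_natCast_atTop_atTop).eventually_gt_atTop C
  filter_upwards [h, eventually_gt_atTop 0] with n hn hn0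
  have hn0' : (0 : ℝ) < n := by exact_mod_cast hn0
  calc C * (n : ℝ) ^ a < (n : ℝ) ^ (b - a) * (n : ℝ) ^ a := by
        gcongr
        exact hn
    _ = _ := by rw [← Real.rpow_add hn0']; ring_nf

lemma eventually_mul_log_le (C : ℝ) {a : ℝ} (ha : 0 < a) :
    ∀ᶠ n : ℕ in atTop, C * (1 + Real.log n) ≤ (n : ℝ) ^ a := by
  have h0 : (fun x : ℝ => C * (1 + Real.log x)) =o[atTop] fun x => x ^ a :=
    (((Asymptotics.isLittleO_const_left.mpr (Or.inr (tendsto_norm_atTop_atTop.comp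
      (tendsto_rpow_atTop ha)))).add (isLittleO_log_rpow_atTop ha)).const_mul_left C)
  have h1 := (h0.comp_tendsto tendsto_natCast_atTop_atTop).bound zero_lt_one
  filter_upwards [h1] with n hn
  have h2 : ‖(n : ℝ) ^ a‖ = (n : ℝ) ^ a := Real.norm_of_nonneg (by positivity)
  simp only [Function.comp, one_mul, h2] at hn
  exact (le_abs_self _).trans hn

lemma eventually_largeGrid {k : ℕ} (hk : 0 < k) {γ ε : ℝ} (hε : 0 < ε) (hεγ : 2 * ε < γ) :
    ∀ᶠ n : ℕ in atTop, ∃ E : ℝ, LargeGrid n k γ ε E := by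
  have hk0 : (0 : ℝ) < k := by exact_mod_cast hk
  have hγ : 0 < γ := by linarith
  -- With `E = n^η`, the conditions on the exponents are `3η < γ`, `2η < εγ/k` and `3η < γ - 2ε`.
  obtain ⟨η, hη, h3, h4⟩ : ∃ η : ℝ, 0 < η ∧ 4 * η ≤ ε / k * γ ∧ 4 * η ≤ γ - 2 * ε := by
    refine ⟨min (ε / k * γ) (γ - 2 * ε) / 4, ?_, ?_, ?_⟩
    · have := lt_min (show 0 < ε / k * γ by positivity) (show 0 < γ - 2 * ε by linarith)
      positivity
    · linarith [min_le_left (ε / k * γ) (γ - 2 * ε)]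
    · linarith [min_le_right (ε / k * γ) (γ - 2 * ε)]
  set K : ℝ := 2 * (k : ℝ) ^ ((k : ℝ) - 1) with hK
  have hK0 : 0 < K := by positivity
  filter_upwards [eventually_gt_atTop 1, eventually_mul_log_le 8 (div_pos hη hk0),
    eventually_mul_rpow_lt (K * (k : ℝ) ^ (1 - γ)) (show 1 - γ + η < 1 - 2 * η by linarith),
    eventually_mul_rpow_lt (2 * K * (2 * (k : ℝ) ^ ((k : ℝ) + 1)))
      (show 1 - ε / k * γ < 1 - 2 * η by linarith),
    eventually_mul_rpow_lt (2 * K * (2 * (k : ℝ) ^ ((k : ℝ) + 1)) * (k : ℝ) ^ (k - γ))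
      (show 1 + ε - k < 1 - 2 * η - ε + (γ - k) - η by linarith)] with n h1 hL hA hB hC
  have hn0 : (0 : ℝ) < n := by exact_mod_cast (by omega : 0 < n)
  have hE2 : ((n : ℝ) ^ η) ^ 2 = (n : ℝ) ^ (2 * η) := by
    rw [← Real.rpow_natCast, ← Real.rpow_mul hn0.le]; congr 1; push_cast; ring
  have ha : n / K / ((n : ℝ) ^ η) ^ 2 = (n : ℝ) ^ (1 - 2 * η) / K := by
    rw [hE2, Real.rpow_sub hn0, Real.rpow_one]; ring
  refine ⟨(n : ℝ) ^ η, h1, fun u => ?_, ?_, ?_, ?_⟩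
  · refine (linkNorm_dim_le u).trans ?_
    have hlog : 0 ≤ Real.log n := Real.log_natCast_nonneg n
    calc (8 * (1 + Real.log n)) ^ k ≤ ((n : ℝ) ^ (η / k)) ^ k := by gcongr
      _ = _ := by
        rw [← Real.rpow_natCast, ← Real.rpow_mul hn0.le]; congr 1; field_simp
  · rw [ha, lt_div_iff₀ hK0]
    refine lt_of_eq_of_lt ?_ hA
    rw [Real.mul_rpow hk0.le hn0.le, Real.rpow_add hn0]; ring
  · rw [ha, div_div, le_div_iff₀ (by positivity)]
    refine le_of_eq_of_le ?_ hB.le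
    ring
  · rw [ha, Real.mul_rpow hk0.le hn0.le]
    have hkγ : (k : ℝ) ^ (γ - k) = ((k : ℝ) ^ (k - γ))⁻¹ := by
      rw [← Real.rpow_neg hk0.le]; ring_nf
    have hr : (n : ℝ) ^ (1 - 2 * η) / K / 2 *
        ((n : ℝ) ^ (-ε) * ((k : ℝ) ^ (γ - k) * (n : ℝ) ^ (γ - k)) / (n : ℝ) ^ η) =
        (n : ℝ) ^ (1 - 2 * η - ε + (γ - k) - η) / (2 * K * (k : ℝ) ^ (k - γ)) := by
      rw [Real.rpow_sub hn0 _ η, Real.rpow_add hn0 (1 - 2 * η - ε), sub_eq_add_neg _ ε,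
        Real.rpow_add hn0 _ (-ε), hkγ]
      field_simp
    rw [hr, lt_div_iff₀ (by positivity)]
    refine lt_of_eq_of_lt ?_ hC
    ring

end Asymptotics

/-! ### Every node has a perturbed neighbour with high probability. -/

section Probability

open Filter Topology

/-- If independent events have probability at least `q`, then with large probability every `u` of
a finite type has one of the events in its neighbourhood `B u` of size `m`. -/
lemma measureReal_forall_exists_mem_ge {ι Ω : Type*} [Fintype ι] [MeasurableSpace Ω]
    {μ : Measure Ω} [IsProbabilityMeasure μ] {A : ι → Set Ω} (hA : ∀ i, MeasurableSet (A i))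
    (hind : iIndepSet A μ) {q : ℝ} (hq : ∀ i, q ≤ μ.real (A i)) {m : ℕ} {B : ι → Finset ι}
    (hB : ∀ u, (B u).card = m) :
    1 - Fintype.card ι * (1 - q) ^ m ≤ μ.real {ω | ∀ u, ∃ v ∈ B u, ω ∈ A v} := by
  have hbad : ∀ u, μ.real (⋂ v ∈ B u, (A v)ᶜ) ≤ (1 - q) ^ m := by
    intro u
    have h := (iIndepSet_iff A μ).mp hind (B u) (f := fun v => (A v)ᶜ) fun v _ =>
      MeasurableSet.compl (MeasurableSpace.measurableSet_generateFrom rfl)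
    rw [measureReal_def, h, ENNReal.toReal_prod, ← hB u, ← Finset.prod_const]
    refine Finset.prod_le_prod (fun _ _ => ENNReal.toReal_nonneg) fun v _ => ?_
    rw [← measureReal_def, probReal_compl_eq_one_sub (hA v)]
    linarith [hq v]
  have hset : {ω | ∀ u, ∃ v ∈ B u, ω ∈ A v} = (⋃ u, ⋂ v ∈ B u, (A v)ᶜ)ᶜ := by
    ext ω; simp
  have hmeas : MeasurableSet (⋃ u, ⋂ v ∈ B u, (A v)ᶜ) :=
    MeasurableSet.iUnion fun u => Finset.measurableSet_biInter _ fun v _ => (hA v).compl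
  rw [hset, probReal_compl_eq_one_sub hmeas]
  have : μ.real (⋃ u, ⋂ v ∈ B u, (A v)ᶜ) ≤ Fintype.card ι * (1 - q) ^ m := by
    refine (measureReal_iUnion_fintype_le _).trans ?_
    refine (Finset.sum_le_sum fun u _ => hbad u).trans ?_
    simp
  linarith

/-- A box of `h^k` nodes with `h ≈ n^δ/k` and `q = n^{-(k-1)δ}` has `q h^k` of order `n^δ`, which
exceeds `(k+1) log n`. The union bound over `n^k` nodes then gives `n^k e^{-(k+1) log n} = 1/n`. -/
lemma eventually_card_mul_pow_le {k : ℕ} (hk : 1 < k) {δ : ℝ} (hδ : 0 < δ) (hδ1 : δ ≤ 1) :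
    ∀ᶠ n : ℕ in atTop, ∃ h < n, ((k * h : ℕ) : ℝ) ≤ (n : ℝ) ^ δ ∧
      (n : ℝ) ^ k * (1 - (n : ℝ) ^ (-((k - 1) * δ))) ^ (h ^ k) ≤ 1 / n := by
  have hk1 : (1 : ℝ) < k := by exact_mod_cast hk
  have hk0 : (0 : ℝ) < k := by linarith
  filter_upwards [eventually_gt_atTop 1, eventually_mul_rpow_lt (2 * k) hδ,
    eventually_mul_log_le ((k + 1) * (2 * k) ^ k) hδ] with n h1 h2 h3
  have hn1 : (1 : ℝ) < n := by exact_mod_cast h1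
  have hn0 : (0 : ℝ) < n := by linarith
  rw [Real.rpow_zero, mul_one] at h2
  have hle := Nat.floor_le (show 0 ≤ (n : ℝ) ^ δ / k by positivity)
  have hlt := Nat.lt_floor_add_one ((n : ℝ) ^ δ / k)
  refine ⟨⌊(n : ℝ) ^ δ / k⌋₊, ?_, ?_, ?_⟩
  · have : (n : ℝ) ^ δ ≤ n := by
      simpa using Real.rpow_le_rpow_of_exponent_le hn1.le hδ1
    have h4 : (n : ℝ) ^ δ / k < n := by
      rw [div_lt_iff₀ hk0]; nlinarith
    exact_mod_cast hle.trans_lt h4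
  · rw [le_div_iff₀ hk0] at hle
    push_cast; linarith
  set h := ⌊(n : ℝ) ^ δ / k⌋₊
  set q := (n : ℝ) ^ (-((k - 1) * δ)) with hq
  have hq1 : q ≤ 1 := Real.rpow_le_one_of_one_le_of_nonpos hn1.le
    (by have : 0 ≤ (k - 1) * δ := mul_nonneg (by linarith) hδ.le
        linarith)
  -- Rounding down loses at most a factor 2, because `n^δ / (2k) ≥ 1`.
  have hh : (n : ℝ) ^ δ / (2 * k) ≤ h := by
    have e1 : (n : ℝ) ^ δ / k = (n : ℝ) ^ δ / (2 * k) + (n : ℝ) ^ δ / (2 * k) := by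
      field_simp; norm_num
    have e2 : 1 ≤ (n : ℝ) ^ δ / (2 * k) := (one_le_div (by positivity)).mpr h2.le
    linarith
  have hexp : (k + 1) * Real.log n ≤ q * (h : ℝ) ^ k := by
    calc (k + 1) * Real.log n ≤ (k + 1) * (1 + Real.log n) := by gcongr; linarith
      _ ≤ (n : ℝ) ^ δ / (2 * k) ^ k := by
        rw [le_div_iff₀ (by positivity)]
        linarith
      _ = q * ((n : ℝ) ^ δ / (2 * k)) ^ k := by
        rw [div_pow, ← Real.rpow_natCast ((n : ℝ) ^ δ), ← Real.rpow_mul hn0.le, mul_div_assoc', hq,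
          ← Real.rpow_add hn0]
        ring_nf
      _ ≤ _ := by gcongr
  calc (n : ℝ) ^ k * (1 - q) ^ (h ^ k) ≤ (n : ℝ) ^ k * Real.exp (-q) ^ (h ^ k) := by
        gcongr
        exact Real.one_sub_le_exp_neg q
    _ = (n : ℝ) ^ k * Real.exp (-(q * (h : ℝ) ^ k)) := by
        rw [← Real.exp_nat_mul]; push_cast; ring_nf
    _ ≤ (n : ℝ) ^ k * Real.exp (-((k + 1) * Real.log n)) := by gcongr
    _ = 1 / n := by
        rw [← neg_mul, mul_comm, ← Real.rpow_natCast, mul_comm _ (Real.log n),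
          ← Real.rpow_def_of_pos hn0, ← Real.rpow_add hn0,
          show (-((k : ℝ) + 1) + k) = -1 by ring, Real.rpow_neg_one, one_div]

lemma locallyPerturbed_of_forall_exists {n k : ℕ} {γ β ρ : ℝ} (hγ : 0 ≤ γ) {S : Finset ℝ}
    (hS : (S : Set ℝ) ⊆ strategySet γ) (hSβ : ∀ s ∈ S, s ≤ β) {r : Profile n k}
    (hr : ∀ u, r u = 0 ∨ r u ∈ S)
    (h : ∀ u, ∃ v, v ≠ u ∧ (gridDist u v : ℝ) ≤ ρ ∧ r v ∈ (S : Set ℝ) \ {0}) :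
    LocallyPerturbed γ β ρ r := by
  refine ⟨fun v => ?_, fun u => ?_⟩
  · rcases hr v with h0 | hv
    · exact h0.ge
    · obtain ⟨m, hm⟩ := hS hv
      rw [hm]; positivity
  · obtain ⟨v, hv, hd, hvS, hv0⟩ := h u
    refine ⟨v, hv, hd, ?_, Or.inl (hSβ _ hvS)⟩
    obtain ⟨m, hm⟩ := hS hvS
    have hm0 : m ≠ 0 := by
      rintro rfl
      exact hv0 (by simpa using hm)
    rw [hm]
    exact le_mul_of_one_le_left hγ (by exact_mod_cast Nat.one_le_iff_ne_zero.mpr hm0)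

end Probability

/-- `R` is the random profile after the perturbation of the profile `r ≡ 0`: every node `u` has
`R u ∈ S \ {0}` independently with probability at least `n ^ (-(k-1)ε/(k+β))`, and otherwise it
keeps the strategy `0`. -/
theorem mainTheorem8 (k : ℕ) (hk : 1 < k) (γ : ℝ) (hγ : ∃ g : ℕ, 2 ≤ g ∧ γ = 1 / (g : ℝ))
    (β : ℝ) (hβ : 0 < β) (ε : ℝ) (hε : 0 < ε) (hεγ : ε < γ / 2) :
    ∃ n₀ : ℕ, ∀ n : ℕ, n₀ ≤ n →
      ∀ S : Finset ℝ, (S : Set ℝ) ⊆ strategySet γ → (∃ s ∈ S, s ≠ 0) → (∀ s ∈ S, s ≤ β) →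
      ∀ (Ω : Type*) [MeasurableSpace Ω] (μ : Measure Ω) [IsProbabilityMeasure μ]
        (R : GridNode n k → Ω → ℝ),
        (∀ u, Measurable (R u)) →
        (∀ u ω, R u ω = 0 ∨ R u ω ∈ S) →
        iIndepSet (fun u => {ω | R u ω ∈ (S : Set ℝ) \ {0}}) μ →
        (∀ u, (n : ℝ) ^ (-(((k : ℝ) - 1) * ε / ((k : ℝ) + β))) ≤
          μ.real {ω | R u ω ∈ (S : Set ℝ) \ {0}}) →
        1 - 1 / (n : ℝ) ≤
          μ.real {ω | SyncReachesNavigable γ (fun u => R u ω) ∧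
            AsyncReachesNavigable γ (fun u => R u ω)} := by
  have hk0 : 0 < k := by omega
  have hk1 : (1 : ℝ) < k := by exact_mod_cast hk
  have hγ0 : 0 < γ := by linarith
  have hγ1 : γ ≤ 1 := by
    obtain ⟨g, hg, rfl⟩ := hγ
    rw [div_le_one (by exact_mod_cast (by omega : 0 < g))]
    exact_mod_cast (by omega : 1 ≤ g)
  have hδ : 0 < ε / (k + β) := by positivity
  have hδ1 : ε / (k + β) ≤ 1 := by
    rw [div_le_one (by positivity)]; linarith
  obtain ⟨n₀, hn₀⟩ := Filter.eventually_atTop.mp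
    ((eventually_largeGrid hk0 hε (show 2 * ε < γ by linarith)).and
      (eventually_card_mul_pow_le hk hδ hδ1))
  refine ⟨n₀, fun n hn S hS hSne hSβ Ω _ μ _ R hR hRS hind hprob => ?_⟩
  obtain ⟨⟨E, hN⟩, h, hhn, hkh, hpow⟩ := hn₀ n hn
  -- A nonzero element of `S` is a positive multiple of `γ` and is at most `β`.
  have hγβ : γ ≤ β := by
    obtain ⟨s, hs, hs0⟩ := hSne
    obtain ⟨m, rfl⟩ := hS hs
    have hm0 : m ≠ 0 := by rintro rfl; simp at hs0
    refine le_trans ?_ (hSβ _ hs)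
    exact le_mul_of_one_le_left hγ0.le (by exact_mod_cast Nat.one_le_iff_ne_zero.mpr hm0)
  choose B hBcard hB using fun u : GridNode n k => exists_near_nodes hk0 hhn u
  have hA : ∀ u, MeasurableSet {ω | R u ω ∈ (S : Set ℝ) \ {0}} := fun u =>
    hR u (S.finite_toSet.measurableSet.diff (measurableSet_singleton 0))
  have hmain := measureReal_forall_exists_mem_ge hA hind hprob hBcard
  have hcard : (Fintype.card (GridNode n k) : ℝ) = (n : ℝ) ^ k := by simp
  rw [hcard, mul_div_assoc] at hmain
  refine le_trans (by linarith) (hmain.trans (measureReal_mono fun ω hω => ?_))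
  have hpert : LocallyPerturbed γ β ((n : ℝ) ^ (ε / (k + β))) (fun u => R u ω) :=
    locallyPerturbed_of_forall_exists hγ0.le hS hSβ (fun u => hRS u ω) fun u => by
      obtain ⟨v, hv, hvω⟩ := hω u
      obtain ⟨hvu, hd⟩ := hB u v hv
      exact ⟨v, hvu, le_trans (by exact_mod_cast hd) hkh, hvω⟩
  exact ⟨syncReachesNavigable hN hk0 hγ hγβ hε.le (by linarith) hpert,
    asyncReachesNavigable hN hk0 hγ hγβ hε.le (by linarith) (by linarith) hpert⟩
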